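/- Consider a MIMO-NOMA downlink in which a base station with $M\ge 1$ antennas serves $M$ clusters of $K\ge 1$ users, each user having $N\ge M$ antennas. Fix a cluster $i\in\{1,\dots,M\}$. The $N\times M$ channel matrices of its $K$ users have (within and across users) i.i.d. $\mathcal{CN}(0,1)$ entries (Rayleigh fading). The precoder is $\mathbf P=\mathbf I_M$ with columns $\mathbf p_1,\dots,\mathbf p_M$. A user with channel matrix $\mathbf H=[\mathbf h_1\,\cdots\,\mathbf h_M]$ uses the detection vector $\mathbf v=\mathbf U\mathbf z$, where the $N-M+1$ columns of $\mathbf U$ are orthonormal vectors in the left null space of $[\mathbf h_m]_{m\ne i}$ (i.e. $\mathbf U^H\mathbf U=\mathbf I$ and $\mathbf U^H\mathbf h_m=0$ for $m\neq i$), and $\mathbf z=\mathbf U^H\mathbf h_i/|\mathbf U^H\mathbf h_i|$ (maximal ratio combining). The users are then ordered by effective channel gain, $|\mathbf v_{i,1}^H\mathbf H_{i,1}\mathbf p_i|^2\ge\cdots\ge|\mathbf v_{i,K}^H\mathbf H_{i,K}\mathbf p_i|^2$. Let $\alpha_{i,1},\dots,\alpha_{i,K}\in\mathbb R$ be fixed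 power allocation coefficients, $R_{i,1},\dots,R_{i,K}>0$ target rates and $\rho>0$ the transmit SNR. The $k$-th ordered user detects the message of the $j$-th ordered user, $j\ge k$, with $$SINR^j_{i,k}=\frac{|\mathbf v_{i,k}^H\mathbf H_{i,k}\mathbf p_i|^2\alpha_{i,j}^2}{\sum_{l=1}^{j-1}|\mathbf v_{i,k}^H\mathbf H_{i,k}\mathbf p_i|^2\alpha_{i,l}^2+\sum_{m\ne i}|\mathbf v_{i,k}^H\mathbf H_{i,k}\mathbf p_m|^2+|\mathbf v_{i,k}|^2\frac1\rho},$$ and its outage probability $\mathrm P^o_{i,k}$ is the probability that $\log_2(1+SINR^j_{i,k})>R_{i,j}$ fails for at least one $j\in\{k,\dots,K\}$. Put $\epsilon_{i,j}=2^{R_{i,j}}-1$ and $\beta_{i,j}=\epsilon_{i,j}\sum_{l=1}^{j-1}\alpha_{i,l}^2$ (so $\beta_{i,1}=0$). Let $1\le k\le K$. If $\alpha_{i,j}^2>\beta_{i,j}$ for all $k\le j\le K$, put $\epsilon^*_{i,k}=\max_{k\le j\le K}\frac{\epsilon_{i,j}}{\rho(\alpha_{i,j}^2-\beta_{i,j})}$.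 Then, for every $\rho>0$, $$\mathrm P^o_{i,k}=\sum_{p=0}^{k-1}\binom{k-1}{p}\frac{(-1)^p\,K!\left[\frac{\gamma(N-M+1,\epsilon^*_{i,k})}{(N-M)!}\right]^{K-k+p+1}}{(K-k)!\,(k-1)!\,(K-k+p+1)},$$ where $\gamma(s,x)=\int_0^x t^{s-1}e^{-t}\,dt$. Moreover, as $\rho\to\infty$ (the ratio of the two sides tends to $1$), $$\mathrm P^o_{i,k}\sim\frac{K!}{(K-k)!\,(k-1)!\,(K-k+1)}\left[\frac{(\epsilon^*_{i,k})^{N-M+1}}{(N-M+1)!}\right]^{K-k+1},$$ and the diversity order is $-\lim_{\rho\to\infty}\frac{\log \mathrm P^o_{i,k}}{\log\rho}=(N-M+1)(K-k+1)$. If $\alpha_{i,j}^2\le\beta_{i,j}$ for some $k\le j\le K$, then $\mathrm P^o_{i,k}=1$ for every $\rho>0$. -/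

import Mathlib

open MeasureTheory ProbabilityTheory Filter Topology Asymptotics
open scoped Matrix Nat

namespace MimoNoma

/-- The circularly symmetric complex Gaussian law `CN(0,1)`: independent real and imaginary
parts, each real Gaussian with mean `0` and variance `1/2`. -/
noncomputable def stdComplexGaussian : Measure ℂ :=
  ((gaussianReal 0 (1 / 2)).prod (gaussianReal 0 (1 / 2))).map
    (fun p : ℝ × ℝ => (⟨p.1, p.2⟩ : ℂ))

/-- Rayleigh fading for the `K` users of a cluster: all entries of all `N × M` channel matrices
are independent and `CN(0,1)`-distributed. -/
structure IsRayleighFading {Ω : Type*} [MeasurableSpace Ω] {N M K : ℕ}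
    (H : Fin K → Ω → Matrix (Fin N) (Fin M) ℂ) (μ : Measure Ω) : Prop where
  law : ∀ u n m, HasLaw (fun ω => H u ω n m) stdComplexGaussian μ
  indep : iIndepFun (fun (t : Fin K × Fin N × Fin M) (ω : Ω) => H t.1 ω t.2.1 t.2.2) μ

/-- Euclidean norm of a complex vector. -/
noncomputable def vecNorm {n : ℕ} (v : Fin n → ℂ) : ℝ :=
  ‖(WithLp.toLp 2 v : EuclideanSpace ℂ (Fin n))‖

/-- The interfering part of a channel matrix: the `i`-th column is removed. -/
def interference {N M : ℕ} (i : Fin M) (H : Matrix (Fin N) (Fin M) ℂ) :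
    Matrix (Fin N) {m : Fin M // m ≠ i} ℂ :=
  H.submatrix id Subtype.val

/-- The `r` columns of `U` are orthonormal left singular vectors of `A` for the singular value
zero, i.e. orthonormal vectors of the left null space of `A`. -/
def IsLeftNullFrame {N r : ℕ} {κ : Type*} (A : Matrix (Fin N) κ ℂ)
    (U : Matrix (Fin N) (Fin r) ℂ) : Prop :=
  Uᴴ * U = 1 ∧ Uᴴ * A = 0

/-- The maximal ratio combining vector `z = Uᴴ h / |Uᴴ h|`. -/
noncomputable def mrc {N r : ℕ} (U : Matrix (Fin N) (Fin r) ℂ) (h : Fin N → ℂ) : Fin r → ℂ :=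
  ((vecNorm (Uᴴ *ᵥ h) : ℂ)⁻¹) • (Uᴴ *ᵥ h)

/-- The detection vector `v = U z`, with `z` the MRC vector for the `i`-th channel column. -/
noncomputable def detection {N M r : ℕ} (i : Fin M) (H : Matrix (Fin N) (Fin M) ℂ)
    (U : Matrix (Fin N) (Fin r) ℂ) : Fin N → ℂ :=
  U *ᵥ mrc U (fun n => H n i)

/-- The effective channel gain `|vᴴ H p|²` for the precoding column `p`. -/
noncomputable def gain {N M : ℕ} (v : Fin N → ℂ) (H : Matrix (Fin N) (Fin M) ℂ)
    (p : Fin M → ℂ) : ℝ :=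
  ‖star v ⬝ᵥ (H *ᵥ p)‖ ^ 2

/-- The SINR with which a user of cluster `i` (channel `H`, detection vector `v`) detects the
message of the `j`-th ordered user of its cluster, the messages of the users after `j` having
been removed; `P` is the precoder, `α` the power allocation, `ρ` the transmit SNR. -/
noncomputable def sinr {N M K : ℕ} (P : Matrix (Fin M) (Fin M) ℂ) (i : Fin M)
    (H : Matrix (Fin N) (Fin M) ℂ) (v : Fin N → ℂ) (α : Fin K → ℝ) (ρ : ℝ) (j : Fin K) : ℝ :=
  gain v H (fun a => P a i) * α j ^ 2 /
    (∑ l ∈ Finset.Iio j, gain v H (fun a => P a i) * α l ^ 2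
      + ∑ m ∈ Finset.univ.erase i, gain v H (fun a => P a m)
      + vecNorm v ^ 2 * (1 / ρ))

/-- `σ` sorts the users by decreasing effective channel gain for the precoder `P = I`:
`σ k` is the user in position `k` (position `0` has the largest gain). -/
def IsGainOrdering {N M K r : ℕ} (i : Fin M) (H : Fin K → Matrix (Fin N) (Fin M) ℂ)
    (U : Fin K → Matrix (Fin N) (Fin r) ℂ) (σ : Equiv.Perm (Fin K)) : Prop :=
  Antitone fun k : Fin K =>
    gain (detection i (H (σ k)) (U (σ k))) (H (σ k))
      (fun a => (1 : Matrix (Fin M) (Fin M) ℂ) a i)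

/-- Outage probability of the `k`-th ordered user of cluster `i` under MIMO-NOMA with `P = I`
and MRC detection: the probability that not all the messages `j ≥ k` can be decoded, where
message `j` is decodable when `log₂(1 + SINR) > R j`. -/
noncomputable def outageProb {Ω : Type*} [MeasurableSpace Ω] (μ : Measure Ω) {N M K r : ℕ}
    (i : Fin M) (H : Fin K → Ω → Matrix (Fin N) (Fin M) ℂ)
    (U : Fin K → Ω → Matrix (Fin N) (Fin r) ℂ) (σ : Ω → Equiv.Perm (Fin K))
    (α R : Fin K → ℝ) (k : Fin K) (ρ : ℝ) : ℝ :=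
  μ.real {ω | ¬ ∀ j : Fin K, k ≤ j →
    R j < Real.logb 2 (1 + sinr 1 i (H (σ ω k) ω)
      (detection i (H (σ ω k) ω) (U (σ ω k) ω)) α ρ j)}

/-- The SINR threshold `ε = 2 ^ R - 1` of a target rate. -/
noncomputable def eps {K : ℕ} (R : Fin K → ℝ) (j : Fin K) : ℝ := (2 : ℝ) ^ R j - 1

/-- `β j = ε j * ∑ l < j, α l ^ 2`. -/
noncomputable def beta {K : ℕ} (α R : Fin K → ℝ) (j : Fin K) : ℝ :=
  eps R j * ∑ l ∈ Finset.Iio j, α l ^ 2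

/-- `ε* k`, the maximum over `j ≥ k` of `ε j / (ρ (α j ^ 2 - β j))`. -/
noncomputable def epsStar {K : ℕ} (α R : Fin K → ℝ) (k : Fin K) (ρ : ℝ) : ℝ :=
  (Finset.Ici k).sup' ⟨k, Finset.mem_Ici.2 le_rfl⟩
    fun j => eps R j / (ρ * (α j ^ 2 - beta α R j))

/-- The lower incomplete gamma function `γ(s, x)`. -/
noncomputable def lowerGamma (s x : ℝ) : ℝ :=
  ∫ t in (0 : ℝ)..x, t ^ (s - 1) * Real.exp (-t)

/-- The closed form of the outage probability at threshold `e`, for the position `1 ≤ k ≤ K`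
(counted from one) and `M ≤ N`. -/
noncomputable def outageClosedForm (N M K k : ℕ) (e : ℝ) : ℝ :=
  ∑ p ∈ Finset.range k, ((k - 1).choose p : ℝ) *
    ((-1) ^ p * (K ! : ℝ) *
        (lowerGamma ((N : ℝ) - M + 1) e / ((N - M)! : ℝ)) ^ (K - k + p + 1) /
      (((K - k)! : ℝ) * ((k - 1)! : ℝ) * ((K : ℝ) - k + p + 1)))

/-- The high-SNR approximation at threshold `e`, for the position `1 ≤ k ≤ K` (counted from
one) and `M ≤ N`. -/
noncomputable def outageHighSNR (N M K k : ℕ) (e : ℝ) : ℝ :=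
  (K ! : ℝ) * (e ^ (N - M + 1) / ((N - M + 1)! : ℝ)) ^ (K - k + 1) /
    (((K - k)! : ℝ) * ((k - 1)! : ℝ) * ((K : ℝ) - k + 1))

end MimoNoma

/-!
# Outage probability of MIMO-NOMA with maximal ratio combining

Fix a user, let `h` be its desired channel column and `B` the family of its `M - 1` interfering
columns. Almost surely `B` is linearly independent (`ae_linearIndependent`), so the columns of any
admissible frame `U` span the orthogonal complement of the span of `B`. Consequently the effective
gain `|Uᴴ h|²` is the squared distance from `h` to the span of `B`, whichever frame is used
(`residual_eq_norm_adjoint`). This removes `U`, on which no measurability is assumed, and leaves a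
measurable function of the user's own channel matrix; the gains of the users are therefore i.i.d.

For fixed `B` and a frame chosen as a function of `B` alone (`exists_frame`), `Uᴴ h` is a standard
complex Gaussian vector of `ℂ^(N-M+1)`, as its characteristic function shows, and integration in
polar coordinates gives the Gamma law of shape `N - M + 1` for its squared norm. This conditional
law does not depend on `B`, hence `measureReal_sq_residual_le`.

Interference is nulled and the detection vector has norm one, so message `j` is decodable exactly
when `ε j / ρ` is less than the gain times `α j ^ 2 - β j` (`lt_logb_sinr_iff`). If some factor
`α j ^ 2 - β j` is nonpositive, outage is certain. Otherwise outage means that the gain in position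
`k` is at most `ε*`, i.e. that at most `k` users (positions counted from zero) have a gain above
`ε*`. This is a binomial tail (`measureReal_card_lt_le`), and comparing derivatives turns it into
the alternating sum of the closed form (`binomialTail_eq`).

Since `ε*` is a constant divided by `ρ`, the high-SNR statements follow from the behaviour of the
closed form at `0⁺`, where the term `p = 0` dominates and `γ(s, x)` is equivalent to `x ^ s / s`.
-/

namespace MimoNoma

/-! ### The binomial tail as an alternating sum -/

/-- The derivatives of the binomial terms telescope. -/
lemma hasDerivAt_binomialTail (K k : ℕ) (hk : k < K) (x : ℝ) :
    HasDerivAt (fun x : ℝ => ∑ j ∈ Finset.range (k + 1),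
        (K.choose j : ℝ) * ((1 - x) ^ j * x ^ (K - j)))
      ((K : ℝ) * ((K - 1).choose k : ℝ) * x ^ (K - 1 - k) * (1 - x) ^ k) x := by
  obtain ⟨L, rfl⟩ : ∃ L, K = L + 1 := ⟨K - 1, by omega⟩
  have hterm : ∀ j, HasDerivAt (fun x : ℝ => ((L + 1).choose j : ℝ) *
      ((1 - x) ^ j * x ^ (L + 1 - j)))
      (((L + 1).choose j : ℝ) * ((j * (1 - x) ^ (j - 1) * (-1)) * x ^ (L + 1 - j)
        + (1 - x) ^ j * (((L + 1 - j : ℕ) : ℝ) * x ^ (L + 1 - j - 1)))) x := by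
    intro j
    have h1 : HasDerivAt (fun x : ℝ => (1 - x) ^ j) (j * (1 - x) ^ (j - 1) * (-1)) x :=
      ((hasDerivAt_id x).const_sub 1).pow j
    exact (h1.mul (hasDerivAt_pow (L + 1 - j) x)).const_mul _
  induction k with
  | zero => simpa using hterm 0
  | succ k ih =>
    have h := (ih (by omega)).add (hterm (k + 1))
    have e1 : L + 1 - (k + 1) = L - k := by omega
    have e2 : L + 1 - 1 - k = L - k := by omega
    have e3 : L - k - 1 = L + 1 - 1 - (k + 1) := by omega
    have c1 : ((L + 1 : ℕ) : ℝ) * (L.choose k : ℝ) =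
        ((L + 1).choose (k + 1) : ℝ) * ((k + 1 : ℕ) : ℝ) := by
      exact_mod_cast Nat.add_one_mul_choose_eq L k
    have c2 : ((L + 1).choose (k + 1) : ℝ) * ((L - k : ℕ) : ℝ)
        = ((L + 1 : ℕ) : ℝ) * (L.choose (k + 1) : ℝ) := by
      have := Nat.choose_mul_succ_eq L (k + 1)
      rw [e1] at this
      rw [mul_comm ((L + 1 : ℕ) : ℝ)]
      exact_mod_cast this.symm
    simp only [Finset.sum_range_succ _ (k + 1)]
    convert! h using 1
    simp only [e1, e3, Nat.add_sub_cancel]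
    linear_combination (-(1 - x) ^ k * x ^ (L - k)) * c1
      - ((1 - x) ^ (k + 1) * x ^ (L - (k + 1))) * c2

lemma hasDerivAt_alternatingTail (K k : ℕ) (hk : k < K) (x : ℝ) :
    HasDerivAt (fun x : ℝ => ∑ p ∈ Finset.range (k + 1), (k.choose p : ℝ) *
        ((-1) ^ p * (K ! : ℝ) * x ^ (K - (k + 1) + p + 1) /
          (((K - (k + 1))! : ℝ) * (k ! : ℝ) * ((K : ℝ) - (k + 1 : ℕ) + p + 1))))
      ((K : ℝ) * ((K - 1).choose k : ℝ) * x ^ (K - 1 - k) * (1 - x) ^ k) x := by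
  obtain ⟨d, rfl⟩ : ∃ d, K = d + k + 1 := ⟨K - (k + 1), by omega⟩
  have e1 : d + k + 1 - (k + 1) = d := by omega
  have e2 : d + k + 1 - 1 - k = d := by omega
  have e3 : d + k + 1 - 1 = d + k := by omega
  rw [e1, e2, e3]
  have hterm : ∀ p ∈ Finset.range (k + 1), HasDerivAt (fun x : ℝ => (k.choose p : ℝ) *
        ((-1) ^ p * ((d + k + 1)! : ℝ) * x ^ (d + p + 1) /
          ((d ! : ℝ) * (k ! : ℝ) * (((d + k + 1 : ℕ) : ℝ) - (k + 1 : ℕ) + p + 1))))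
      (((d + k + 1 : ℕ) : ℝ) * ((d + k).choose k : ℝ) * x ^ d *
        ((-x) ^ p * 1 ^ (k - p) * (k.choose p : ℝ))) x := by
    intro p _
    have h := (((hasDerivAt_pow (d + p + 1) x).const_mul ((-1) ^ p * ((d + k + 1)! : ℝ))).div_const
      ((d ! : ℝ) * (k ! : ℝ) * (((d + k + 1 : ℕ) : ℝ) - (k + 1 : ℕ) + p + 1))).const_mul
      (k.choose p : ℝ)
    convert! h using 1
    have c : ((d + k).choose k : ℝ) * (d ! : ℝ) * (k ! : ℝ) = ((d + k)! : ℝ) := by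
      exact_mod_cast Nat.add_choose_mul_factorial_mul_factorial d k
    have hd : (d ! : ℝ) ≠ 0 := by positivity
    have hk0 : (k ! : ℝ) ≠ 0 := by positivity
    have hden : (d : ℝ) + p + 1 ≠ 0 := by positivity
    rw [Nat.factorial_succ, Nat.cast_mul, ← c, Nat.add_sub_cancel, neg_pow x p, pow_add x d p]
    have : ((d + k + 1 : ℕ) : ℝ) - (k + 1 : ℕ) + p + 1 = d + p + 1 := by push_cast; ring
    rw [this]
    push_cast
    rw [one_pow]
    field_simp
  have h := HasDerivAt.fun_sum hterm
  convert! h using 1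
  rw [← Finset.mul_sum, ← add_pow]
  ring

/-- The lower tail of a binomial distribution as an alternating sum: both sides are primitives of
`K * (K-1).choose k * x ^ (K-1-k) * (1-x) ^ k` that vanish at `0`. -/
lemma binomialTail_eq (K k : ℕ) (hk : k < K) (x : ℝ) :
    ∑ j ∈ Finset.range (k + 1), (K.choose j : ℝ) * ((1 - x) ^ j * x ^ (K - j)) =
      ∑ p ∈ Finset.range (k + 1), (k.choose p : ℝ) *
        ((-1) ^ p * (K ! : ℝ) * x ^ (K - (k + 1) + p + 1) /
          (((K - (k + 1))! : ℝ) * (k ! : ℝ) * ((K : ℝ) - (k + 1 : ℕ) + p + 1))) := by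
  have h := is_const_of_deriv_eq_zero (𝕜 := ℝ)
    (f := fun x : ℝ => ∑ j ∈ Finset.range (k + 1), (K.choose j : ℝ) * ((1 - x) ^ j * x ^ (K - j)) -
      ∑ p ∈ Finset.range (k + 1), (k.choose p : ℝ) *
        ((-1) ^ p * (K ! : ℝ) * x ^ (K - (k + 1) + p + 1) /
          (((K - (k + 1))! : ℝ) * (k ! : ℝ) * ((K : ℝ) - (k + 1 : ℕ) + p + 1))))
    (fun y => ((hasDerivAt_binomialTail K k hk y).sub
      (hasDerivAt_alternatingTail K k hk y)).differentiableAt)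
    (fun y => by
      simpa only [sub_self] using ((hasDerivAt_binomialTail K k hk y).fun_sub
        (hasDerivAt_alternatingTail K k hk y)).deriv) x 0
  have h0 : ∑ j ∈ Finset.range (k + 1), (K.choose j : ℝ) * ((1 - (0 : ℝ)) ^ j * 0 ^ (K - j)) = 0 :=
    Finset.sum_eq_zero fun j hj => by
      rw [zero_pow (by have := Finset.mem_range.1 hj; omega)]; simp
  simp only [h0] at h
  simpa [sub_eq_zero] using h

/-! ### Behaviour of the closed form near zero -/

lemma lowerGamma_natCast_add_one (d : ℕ) (x : ℝ) :
    lowerGamma ((d : ℝ) + 1) x = ∫ t in (0 : ℝ)..x, t ^ d * Real.exp (-t) := by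
  simp [lowerGamma]

lemma lowerGamma_le (d : ℕ) {x : ℝ} (hx : 0 ≤ x) :
    lowerGamma ((d : ℝ) + 1) x ≤ x ^ (d + 1) / (d + 1 : ℝ) := by
  rw [lowerGamma_natCast_add_one]
  calc _ ≤ ∫ t in (0 : ℝ)..x, t ^ d := by
        apply intervalIntegral.integral_mono_on hx
          (Continuous.intervalIntegrable (by fun_prop) _ _)
          (Continuous.intervalIntegrable (by fun_prop) _ _)
        intro t ht
        exact mul_le_of_le_one_right (pow_nonneg ht.1 _) (Real.exp_le_one_iff.2 (by linarith [ht.1]))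
    _ = _ := by simp

lemma le_lowerGamma (d : ℕ) {x : ℝ} (hx : 0 ≤ x) :
    Real.exp (-x) * (x ^ (d + 1) / (d + 1 : ℝ)) ≤ lowerGamma ((d : ℝ) + 1) x := by
  rw [lowerGamma_natCast_add_one]
  calc _ = ∫ t in (0 : ℝ)..x, Real.exp (-x) * t ^ d := by simp
    _ ≤ _ := by
        apply intervalIntegral.integral_mono_on hx
          (Continuous.intervalIntegrable (by fun_prop) _ _)
          (Continuous.intervalIntegrable (by fun_prop) _ _)
        intro t ht
        rw [mul_comm]
        exact mul_le_mul_of_nonneg_left (Real.exp_le_exp.2 (by linarith [ht.2]))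
          (pow_nonneg ht.1 _)

lemma isEquivalent_lowerGamma (d : ℕ) :
    (fun x : ℝ => lowerGamma ((d : ℝ) + 1) x / (d ! : ℝ)) ~[𝓝[>] 0]
      fun x : ℝ => x ^ (d + 1) / ((d + 1)! : ℝ) := by
  have hne : ∀ᶠ x : ℝ in 𝓝[>] 0, x ^ (d + 1) / ((d + 1)! : ℝ) ≠ 0 := by
    filter_upwards [self_mem_nhdsWithin] with x hx
    have : 0 < x := hx
    positivity
  rw [isEquivalent_iff_tendsto_one hne]
  have hlim : Tendsto (fun x : ℝ => Real.exp (-x)) (𝓝[>] 0) (𝓝 1) := by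
    have : Continuous fun x : ℝ => Real.exp (-x) := by fun_prop
    simpa using (this.tendsto 0).mono_left nhdsWithin_le_nhds
  refine tendsto_of_tendsto_of_tendsto_of_le_of_le' hlim tendsto_const_nhds ?_ ?_
  all_goals
    filter_upwards [self_mem_nhdsWithin] with x hx
    have hx : 0 < x := hx
    have hf : ((d + 1)! : ℝ) = (d + 1) * (d ! : ℝ) := by
      rw [Nat.factorial_succ]; push_cast; ring
    have hd : 0 < (d ! : ℝ) := by positivity
    have h1 := lowerGamma_le d hx.le
    have h2 := le_lowerGamma d hx.le
    have hq : lowerGamma ((d : ℝ) + 1) x / (d ! : ℝ) / (x ^ (d + 1) / ((d + 1)! : ℝ)) =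
      lowerGamma ((d : ℝ) + 1) x / (x ^ (d + 1) / (d + 1 : ℝ)) := by
      rw [hf]; field_simp
    simp only [Pi.div_apply]
    rw [hq]
  · rw [le_div_iff₀ (by positivity)]; exact h2
  · rw [div_le_iff₀ (by positivity), one_mul]; exact h1

/-- As `e → 0⁺` the closed form is equivalent to its summand `p = 0`, in which the incomplete
gamma function is replaced by its leading term. -/
lemma isEquivalent_outageClosedForm {N M K k : ℕ} (hMN : M ≤ N) (hk : k < K) :
    outageClosedForm N M K (k + 1) ~[𝓝[>] 0] outageHighSNR N M K (k + 1) := by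
  obtain ⟨d, rfl⟩ := Nat.exists_eq_add_of_le hMN
  have hs : (((M + d : ℕ) : ℝ) - M + 1) = (d : ℝ) + 1 := by push_cast; ring
  have hd : M + d - M = d := by omega
  set F : ℝ → ℝ := fun x => lowerGamma ((d : ℝ) + 1) x / (d ! : ℝ) with hF
  have hFe : F ~[𝓝[>] 0] fun x : ℝ => x ^ (d + 1) / ((d + 1)! : ℝ) := isEquivalent_lowerGamma d
  have hF0 : Tendsto F (𝓝[>] 0) (𝓝 0) := by
    refine hFe.symm.tendsto_nhds ?_
    have : Continuous fun x : ℝ => x ^ (d + 1) / ((d + 1)! : ℝ) := by fun_prop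
    simpa using (this.tendsto 0).mono_left nhdsWithin_le_nhds
  set c : ℝ := (K ! : ℝ) / (((K - (k + 1))! : ℝ) * (k ! : ℝ) * ((K : ℝ) - (k + 1 : ℕ) + 1)) with hc
  have hcF : (fun x => c * F x ^ (K - (k + 1) + 1)) ~[𝓝[>] 0] outageHighSNR (M + d) M K (k + 1) := by
    have h := (IsEquivalent.refl (u := fun _ : ℝ => c)).mul (hFe.pow (K - (k + 1) + 1))
    refine IsEquivalent.congr_right h (Eventually.of_forall fun x => ?_)
    simp only [outageHighSNR, hd, hc, Pi.pow_apply, Pi.mul_apply, Nat.add_sub_cancel]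
    ring
  refine IsEquivalent.trans ?_ hcF
  have hsplit : outageClosedForm (M + d) M K (k + 1) = fun x =>
      (∑ p ∈ Finset.range k, (k.choose (p + 1) : ℝ) * ((-1) ^ (p + 1) * (K ! : ℝ) *
        F x ^ (K - (k + 1) + (p + 1) + 1) / (((K - (k + 1))! : ℝ) * (k ! : ℝ) *
          ((K : ℝ) - (k + 1 : ℕ) + (p + 1 : ℕ) + 1)))) + c * F x ^ (K - (k + 1) + 1) := by
    funext x
    simp only [outageClosedForm, hs, hd, hF, Nat.add_sub_cancel]
    rw [Finset.sum_range_succ']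
    simp only [hc, Nat.choose_zero_right]
    simp
    ring
  -- It remains to see that the terms `p ≥ 1` carry an additional factor `F x ^ p = o(1)`.
  rw [IsEquivalent, hsplit]
  have : ((fun x => (∑ p ∈ Finset.range k, (k.choose (p + 1) : ℝ) * ((-1) ^ (p + 1) * (K ! : ℝ) *
        F x ^ (K - (k + 1) + (p + 1) + 1) / (((K - (k + 1))! : ℝ) * (k ! : ℝ) *
          ((K : ℝ) - (k + 1 : ℕ) + (p + 1 : ℕ) + 1)))) + c * F x ^ (K - (k + 1) + 1)) -
      fun x => c * F x ^ (K - (k + 1) + 1)) = fun x => ∑ p ∈ Finset.range k,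
        ((k.choose (p + 1) : ℝ) * ((-1) ^ (p + 1) * (K ! : ℝ) /
        (((K - (k + 1))! : ℝ) * (k ! : ℝ) *
          ((K : ℝ) - (k + 1 : ℕ) + (p + 1 : ℕ) + 1)))) * F x ^ (K - (k + 1) + (p + 1) + 1) := by
    funext x
    simp only [Pi.sub_apply, add_sub_cancel_right]
    exact Finset.sum_congr rfl fun p _ => by ring
  rw [this]
  refine IsLittleO.fun_sum fun p _ => ?_
  have hc0 : c ≠ 0 := by
    have : ((K : ℝ) - (k + 1 : ℕ) + 1) ≠ 0 := by
      have : (k : ℝ) < K := by exact_mod_cast hk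
      push_cast; linarith
    rw [hc]
    positivity
  refine IsLittleO.const_mul_left (IsLittleO.const_mul_right' (isUnit_iff_ne_zero.2 hc0) ?_) _
  have h1 := (isLittleO_one_iff ℝ).2 (show Tendsto (fun x => F x ^ (p + 1)) (𝓝[>] 0) (𝓝 0) by
    simpa using hF0.pow (p + 1))
  have h2 := (isBigO_refl (fun x => F x ^ (K - (k + 1) + 1)) (𝓝[>] 0)).mul_isLittleO h1
  refine h2.congr' (Eventually.of_forall fun x => ?_) (Eventually.of_forall fun x => by simp)
  simp only [← pow_add]
  congr 1
  omega

/-- Diversity order: a function equivalent to the high-SNR approximation at a threshold `c / ρ`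
decays like `ρ ^ (-(N - M + 1) * (K - k))`. -/
lemma tendsto_neg_log_div_log {N M K k : ℕ} (hk : k < K) {c : ℝ} (hc : 0 < c)
    {f : ℝ → ℝ} (hf : f ~[atTop] fun ρ => outageHighSNR N M K (k + 1) (c / ρ)) :
    Tendsto (fun ρ : ℝ => -Real.log (f ρ) / Real.log ρ) atTop
      (𝓝 ((((N - M + 1) * (K - (k + 1) + 1) : ℕ)) : ℝ)) := by
  set D : ℕ := (N - M + 1) * (K - (k + 1) + 1) with hD
  set C : ℝ := (K ! : ℝ) * (c ^ (N - M + 1) / ((N - M + 1)! : ℝ)) ^ (K - (k + 1) + 1) /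
    (((K - (k + 1))! : ℝ) * ((k + 1 - 1)! : ℝ) * ((K : ℝ) - (k + 1 : ℕ) + 1)) with hC
  have hden : (0 : ℝ) < (K : ℝ) - (k + 1 : ℕ) + 1 := by
    have : (k : ℝ) < K := by exact_mod_cast hk
    push_cast; linarith
  have hC0 : 0 < C := by positivity
  have hg : ∀ ρ : ℝ, outageHighSNR N M K (k + 1) (c / ρ) = C / ρ ^ D := by
    intro ρ
    rw [outageHighSNR, hC, hD, pow_mul, div_pow c ρ, div_right_comm (c ^ _), div_pow _ (ρ ^ _)]
    ring
  have hne : ∀ᶠ ρ : ℝ in atTop, outageHighSNR N M K (k + 1) (c / ρ) ≠ 0 := by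
    filter_upwards [eventually_gt_atTop 0] with ρ hρ
    rw [hg]; positivity
  have hq := (isEquivalent_iff_tendsto_one hne).1 hf
  have hlogq : Tendsto (fun ρ => Real.log ((f / fun ρ => outageHighSNR N M K (k + 1) (c / ρ)) ρ))
      atTop (𝓝 0) := by
    simpa using hq.log one_ne_zero
  have hmain : Tendsto (fun ρ => (D : ℝ) - (Real.log ((f / fun ρ =>
      outageHighSNR N M K (k + 1) (c / ρ)) ρ) + Real.log C) / Real.log ρ) atTop (𝓝 (D - 0)) :=
    ((hlogq.add_const _).div_atTop Real.tendsto_log_atTop).const_sub _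
  rw [sub_zero] at hmain
  refine hmain.congr' ?_
  filter_upwards [eventually_gt_atTop 1, hq.eventually_ne one_ne_zero] with ρ hρ hρq
  have hlog : Real.log ρ ≠ 0 := (Real.log_pos hρ).ne'
  have hρ0 : 0 < ρ := by linarith
  have hfρ : f ρ ≠ 0 := by
    intro h; apply hρq; simp [h]
  simp only [Pi.div_apply, hg]
  rw [Real.log_div hfρ (by positivity), Real.log_div hC0.ne' (by positivity), Real.log_pow]
  field_simp
  ring

/-! ### Order statistics of i.i.d. random variables -/

/-- The entry in position `k` of a decreasing arrangement is at most `e` exactly when at most `k`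
entries exceed `e` (positions are counted from zero). -/
lemma le_iff_card_lt_le {K : ℕ} (g : Fin K → ℝ) (σ : Equiv.Perm (Fin K))
    (hσ : Antitone fun k => g (σ k)) (k : Fin K) (e : ℝ) :
    g (σ k) ≤ e ↔ (Finset.univ.filter fun u => e < g u).card ≤ (k : ℕ) := by
  constructor
  · intro h
    have hsub : (Finset.univ.filter fun u => e < g u) ⊆ (Finset.Iio k).map σ.toEmbedding := by
      intro u hu
      rw [Finset.mem_filter] at hu
      refine Finset.mem_map.2 ⟨σ.symm u, Finset.mem_Iio.2 ?_, by simp⟩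
      by_contra! hle
      have := hσ hle
      simp only [Equiv.apply_symm_apply] at this
      linarith [hu.2]
    simpa using Finset.card_le_card hsub
  · intro h
    by_contra! hlt
    have hsub : (Finset.Iic k).map σ.toEmbedding ⊆ (Finset.univ.filter fun u => e < g u) := by
      intro u hu
      obtain ⟨j, hj, rfl⟩ := Finset.mem_map.1 hu
      exact Finset.mem_filter.2 ⟨Finset.mem_univ _, hlt.trans_le (hσ (Finset.mem_Iic.1 hj))⟩
    have := Finset.card_le_card hsub
    simp at this
    omega

lemma measureReal_card_lt_le_of_measurable {Ω : Type*} [MeasurableSpace Ω] {μ : Measure Ω}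
    [IsProbabilityMeasure μ] {K : ℕ} {g : Fin K → Ω → ℝ} (hg : ∀ u, Measurable (g u))
    (hind : iIndepFun g μ) {e F : ℝ} (hF : ∀ u, μ.real {ω | g u ω ≤ e} = F) {k : ℕ} (hk : k < K) :
    μ.real {ω | (Finset.univ.filter fun u => e < g u ω).card ≤ k} =
      ∑ j ∈ Finset.range (k + 1), (K.choose j : ℝ) * ((1 - F) ^ j * F ^ (K - j)) := by
  classical
  have hF' : ∀ u, μ.real {ω | e < g u ω} = 1 - F := by
    intro u
    rw [← hF u, ← probReal_compl_eq_one_sub (measurableSet_le (hg u) measurable_const)]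
    congr 1
    ext ω
    simp
  -- `B S` is the event that exactly the users in `S` exceed the level.
  set B : Finset (Fin K) → Set Ω := fun S => ⋂ u ∈ (Finset.univ : Finset (Fin K)),
    g u ⁻¹' (if u ∈ S then Set.Ioi e else Set.Iic e) with hB
  have hmem : ∀ S ω, ω ∈ B S ↔ (Finset.univ.filter fun u => e < g u ω) = S := by
    intro S ω
    simp only [hB, Set.mem_iInter, Finset.mem_univ, true_implies, Set.mem_preimage, Finset.ext_iff,
      Finset.mem_filter, true_and]
    refine forall_congr' fun u => ?_
    by_cases hu : u ∈ S <;> simp [hu]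
  have hBmeas : ∀ S, MeasurableSet (B S) := fun S =>
    Finset.measurableSet_biInter _ fun u _ => hg u (by split_ifs <;> measurability)
  have hBreal : ∀ S, μ.real (B S) = (1 - F) ^ S.card * F ^ (K - S.card) := by
    intro S
    rw [measureReal_def, hB, hind.measure_inter_preimage_eq_mul Finset.univ
      (fun u _ => by split_ifs <;> measurability), ENNReal.toReal_prod]
    have : ∀ u, (μ (g u ⁻¹' (if u ∈ S then Set.Ioi e else Set.Iic e))).toReal =
        if u ∈ S then 1 - F else F := by
      intro u
      split_ifs
      · exact hF' u
      · exact hF u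
    simp_rw [this]
    rw [Finset.prod_ite, Finset.prod_const, Finset.prod_const]
    congr 2
    · simp
    · rw [Finset.filter_not, Finset.card_sdiff_of_subset (Finset.filter_subset _ _)]
      simp
  have hU : {ω | (Finset.univ.filter fun u => e < g u ω).card ≤ k} =
      ⋃ S ∈ (Finset.univ : Finset (Fin K)).powerset.filter (fun S => S.card ≤ k), B S := by
    ext ω
    simp only [Set.mem_iUnion, hmem]
    simp
  rw [hU, measureReal_biUnion_finset]
  · simp_rw [hBreal]
    rw [Finset.sum_filter]
    have := Finset.sum_powerset_apply_card
      (fun m => if m ≤ k then (1 - F) ^ m * F ^ (K - m) else 0)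
      (x := (Finset.univ : Finset (Fin K)))
    rw [this, Finset.card_univ, Fintype.card_fin]
    rw [← Finset.sum_subset (Finset.range_mono (show k + 1 ≤ K + 1 by omega))]
    · refine Finset.sum_congr rfl fun j hj => ?_
      rw [if_pos (by have := Finset.mem_range.1 hj; omega), nsmul_eq_mul]
    · intro j _ hj
      rw [if_neg (by rw [Finset.mem_range] at hj; omega), smul_zero]
  · intro S _ T _ hST
    refine Set.disjoint_left.2 fun ω hS hT => hST ?_
    rw [← (hmem S ω).1 hS, (hmem T ω).1 hT]
  · exact fun S _ => hBmeas S

/-- The number of exceedances of a level by i.i.d. random variables is binomially distributed. -/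
lemma measureReal_card_lt_le {Ω : Type*} [MeasurableSpace Ω] {μ : Measure Ω}
    [IsProbabilityMeasure μ] {K : ℕ} {g : Fin K → Ω → ℝ} (hg : ∀ u, AEMeasurable (g u) μ)
    (hind : iIndepFun g μ) {e F : ℝ} (hF : ∀ u, μ.real {ω | g u ω ≤ e} = F) {k : ℕ} (hk : k < K) :
    μ.real {ω | (Finset.univ.filter fun u => e < g u ω).card ≤ k} =
      ∑ j ∈ Finset.range (k + 1), (K.choose j : ℝ) * ((1 - F) ^ j * F ^ (K - j)) := by
  have hae : ∀ᵐ ω ∂μ, ∀ u, g u ω = (hg u).mk (g u) ω := ae_all_iff.2 fun u => (hg u).ae_eq_mk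
  have hcdf : ∀ u, μ.real {ω | (hg u).mk (g u) ω ≤ e} = F := by
    intro u
    rw [← hF u]
    refine measureReal_congr ?_
    filter_upwards [hae] with ω hω
    refine propext ?_
    change _ ≤ e ↔ _ ≤ e
    rw [hω u]
  rw [← measureReal_card_lt_le_of_measurable (fun u => (hg u).measurable_mk)
    (hind.congr fun u => (hg u).ae_eq_mk) hcdf hk]
  refine measureReal_congr ?_
  filter_upwards [hae] with ω hω
  refine propext ?_
  change _ ≤ k ↔ _ ≤ k
  simp_rw [hω]

/-! ### The squared norm of a Gaussian vector -/

section RadialGaussian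

variable {E : Type*} [NormedAddCommGroup E] [InnerProductSpace ℝ E] [FiniteDimensional ℝ E]
  [MeasurableSpace E] [BorelSpace E]

lemma integral_exp_neg_sq_norm_pos : 0 < ∫ x : E, Real.exp (-‖x‖ ^ 2) := by
  have h := GaussianFourier.integral_rexp_neg_mul_sq_norm (V := E) one_pos
  simp only [neg_mul, one_mul] at h
  rw [h]
  positivity

lemma integrable_exp_neg_sq_norm : Integrable fun x : E => Real.exp (-‖x‖ ^ 2) := by
  by_contra h
  exact (integral_exp_neg_sq_norm_pos (E := E)).ne' (integral_undef h)

/-- A probability measure with characteristic function `exp (-‖t‖² / 4)` has a density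
proportional to `exp (-‖x‖²)`. -/
lemma eq_withDensity_of_charFun {μ : Measure E} [IsProbabilityMeasure μ]
    (hμ : ∀ t, charFun μ t = Complex.exp (-(‖t‖ : ℂ) ^ 2 / 4)) :
    μ = volume.withDensity fun x =>
      ENNReal.ofReal (Real.exp (-‖x‖ ^ 2) / ∫ y : E, Real.exp (-‖y‖ ^ 2)) := by
  set C := ∫ y : E, Real.exp (-‖y‖ ^ 2) with hC
  have hC0 : 0 < C := integral_exp_neg_sq_norm_pos
  have hfin : IsFiniteMeasure (volume.withDensity fun x : E =>
      ENNReal.ofReal (Real.exp (-‖x‖ ^ 2) / C)) :=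
    isFiniteMeasure_withDensity_ofReal (integrable_exp_neg_sq_norm.div_const C).2
  refine Measure.ext_of_charFun (funext fun t => ?_)
  rw [hμ, charFun_apply, integral_withDensity_eq_integral_toReal_smul₀ (by fun_prop)
    (Eventually.of_forall fun x => ENNReal.ofReal_lt_top)]
  have hnn : ∀ x : E, 0 ≤ Real.exp (-‖x‖ ^ 2) / C := fun x => by positivity
  have h1 : ∀ x : E, (ENNReal.ofReal (Real.exp (-‖x‖ ^ 2) / C)).toReal •
      Complex.exp ((inner ℝ x t : ℝ) * Complex.I) =
      (C : ℂ)⁻¹ * Complex.exp (-1 * ‖x‖ ^ 2 + Complex.I * (inner ℝ t x : ℝ)) := by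
    intro x
    rw [ENNReal.toReal_ofReal (hnn x), Complex.real_smul, Complex.exp_add, real_inner_comm t x]
    push_cast
    ring_nf
  have hCc : (C : ℂ) = (Real.pi / 1 : ℂ) ^ (Module.finrank ℝ E / 2 : ℂ) := by
    rw [← GaussianFourier.integral_cexp_neg_mul_sq_norm (V := E) (b := 1) (by simp), hC]
    refine Eq.trans integral_complex_ofReal.symm
      (integral_congr_ae (Eventually.of_forall fun x => ?_))
    simp
  simp_rw [h1]
  rw [integral_const_mul, GaussianFourier.integral_cexp_neg_mul_sq_norm_add (by simp), ← hCc,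
    ← mul_assoc, inv_mul_cancel₀ (by exact_mod_cast hC0.ne'), one_mul]
  congr 1
  rw [Complex.I_sq]
  ring

/-- Integrals of functions of `‖x‖²` in even dimension, up to a constant that depends on the
dimension only. -/
lemma exists_integral_sq_norm_eq (d : ℕ) (hE : Module.finrank ℝ E = 2 * (d + 1)) :
    ∃ c : ℝ, ∀ f : ℝ → ℝ, ∫ x : E, f (‖x‖ ^ 2) = c * ∫ t in Set.Ioi (0 : ℝ), t ^ d * f t := by
  have : Nontrivial E := Module.nontrivial_of_finrank_pos (R := ℝ) (by omega)
  refine ⟨(d + 1) * (volume : Measure E).real (Metric.ball 0 1), fun f => ?_⟩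
  rw [integral_fun_norm_addHaar volume (fun y => f (y ^ 2)), hE,
    ← integral_comp_rpow_Ioi_of_pos (g := fun t => t ^ d * f t) (two_pos : (0 : ℝ) < 2)]
  simp only [nsmul_eq_mul, smul_eq_mul, Real.rpow_two]
  have : ∀ x ∈ Set.Ioi (0 : ℝ), 2 * x ^ ((2 : ℝ) - 1) * ((x ^ 2) ^ d * f (x ^ 2)) =
      2 * (x ^ (2 * (d + 1) - 1) * f (x ^ 2)) := by
    intro x _
    rw [show (2 : ℝ) - 1 = 1 by norm_num, Real.rpow_one, ← pow_mul,
      show 2 * (d + 1) - 1 = 2 * d + 1 by omega]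
    ring
  rw [setIntegral_congr_fun measurableSet_Ioi this, integral_const_mul]
  push_cast
  ring

/-- In dimension `2 (d + 1)` the squared norm of a Gaussian vector with density proportional to
`exp (-‖x‖²)` follows the Gamma law of shape `d + 1`. -/
lemma measureReal_sq_norm_le {μ : Measure E} [IsProbabilityMeasure μ]
    (hμ : ∀ t, charFun μ t = Complex.exp (-(‖t‖ : ℂ) ^ 2 / 4)) (d : ℕ)
    (hE : Module.finrank ℝ E = 2 * (d + 1)) {e : ℝ} (he : 0 ≤ e) :
    μ.real {x | ‖x‖ ^ 2 ≤ e} = lowerGamma ((d : ℝ) + 1) e / (d ! : ℝ) := by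
  obtain ⟨c, hc⟩ := exists_integral_sq_norm_eq (E := E) d hE
  have hC0 : 0 < ∫ y : E, Real.exp (-‖y‖ ^ 2) := integral_exp_neg_sq_norm_pos
  have hC : ∫ y : E, Real.exp (-‖y‖ ^ 2) = c * (d ! : ℝ) := by
    rw [hc fun t => Real.exp (-t), ← Real.Gamma_nat_eq_factorial,
      Real.Gamma_eq_integral (by positivity)]
    simp only [add_sub_cancel_right, Real.rpow_natCast]
    congr 1
    exact setIntegral_congr_fun measurableSet_Ioi fun x _ => mul_comm _ _
  have hmeas : MeasurableSet {x : E | ‖x‖ ^ 2 ≤ e} :=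
    measurableSet_le (by fun_prop) measurable_const
  have hnn : ∀ x : E, 0 ≤ Real.exp (-‖x‖ ^ 2) / ∫ y : E, Real.exp (-‖y‖ ^ 2) :=
    fun x => by positivity
  rw [eq_withDensity_of_charFun hμ, measureReal_def, withDensity_apply _ hmeas,
    ← ofReal_integral_eq_lintegral_ofReal
      (integrable_exp_neg_sq_norm.div_const _).integrableOn (Eventually.of_forall hnn),
    ENNReal.toReal_ofReal (integral_nonneg hnn), integral_div, ← integral_indicator hmeas]
  have h1 : ∀ x : E, {x : E | ‖x‖ ^ 2 ≤ e}.indicator (fun x => Real.exp (-‖x‖ ^ 2)) x =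
      (fun t => (Set.Iic e).indicator (fun t => Real.exp (-t)) t) (‖x‖ ^ 2) := by
    intro x
    by_cases hx : ‖x‖ ^ 2 ≤ e <;> simp [hx]
  simp_rw [h1]
  rw [hc fun t => (Set.Iic e).indicator (fun t => Real.exp (-t)) t, hC]
  have h2 : ∀ t : ℝ, t ^ d * (Set.Iic e).indicator (fun t => Real.exp (-t)) t =
      (Set.Iic e).indicator (fun t => t ^ d * Real.exp (-t)) t := by
    intro t
    by_cases ht : t ≤ e <;> simp [ht]
  simp_rw [h2]
  rw [integral_indicator measurableSet_Iic, Measure.restrict_restrict measurableSet_Iic,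
    Set.Iic_inter_Ioi, ← intervalIntegral.integral_of_le he, ← lowerGamma_natCast_add_one]
  rw [hC] at hC0
  have : c ≠ 0 := fun h => by simp [h] at hC0
  rw [mul_div_mul_left _ _ this]

end RadialGaussian

/-! ### Complex Gaussian vectors -/

instance : IsProbabilityMeasure stdComplexGaussian :=
  Measure.isProbabilityMeasure_map Complex.measurableEquivRealProd.symm.measurable.aemeasurable

lemma charFun_stdComplexGaussian (t : ℂ) :
    charFun stdComplexGaussian t = Complex.exp (-(‖t‖ : ℂ) ^ 2 / 4) := by
  have hmeas : Measurable fun p : ℝ × ℝ => (⟨p.1, p.2⟩ : ℂ) :=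
    Complex.measurableEquivRealProd.symm.measurable
  rw [charFun_apply, stdComplexGaussian, integral_map hmeas.aemeasurable (by fun_prop)]
  have h1 : ∀ p : ℝ × ℝ, Complex.exp ((inner ℝ (⟨p.1, p.2⟩ : ℂ) t : ℝ) * Complex.I) =
      Complex.exp (t.re * p.1 * Complex.I) * Complex.exp (t.im * p.2 * Complex.I) := by
    intro p
    rw [← Complex.exp_add, Complex.inner]
    congr 1
    simp
    ring
  simp_rw [h1]
  rw [integral_prod_mul (fun x : ℝ => Complex.exp (t.re * x * Complex.I))
    (fun x : ℝ => Complex.exp (t.im * x * Complex.I)), ← charFun_apply_real, ← charFun_apply_real,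
    charFun_gaussianReal, charFun_gaussianReal, ← Complex.exp_add]
  congr 1
  have : (‖t‖ : ℂ) ^ 2 = (t.re : ℂ) ^ 2 + (t.im : ℂ) ^ 2 := by
    have := Complex.sq_norm t
    rw [Complex.normSq_apply] at this
    rw [← Complex.ofReal_pow, this]
    push_cast
    ring
  rw [this]
  push_cast
  ring

/-- The law of a vector of `n` independent `CN(0,1)` variables, on the Euclidean space `ℂⁿ`. -/
noncomputable def complexGaussian (n : ℕ) : Measure (EuclideanSpace ℂ (Fin n)) :=
  (Measure.pi fun _ => stdComplexGaussian).map (WithLp.toLp 2)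

instance (n : ℕ) : IsProbabilityMeasure (complexGaussian n) :=
  Measure.isProbabilityMeasure_map (by fun_prop)

lemma charFun_complexGaussian {n : ℕ} (t : EuclideanSpace ℂ (Fin n)) :
    charFun (complexGaussian n) t = Complex.exp (-(‖t‖ : ℂ) ^ 2 / 4) := by
  rw [complexGaussian, charFun_pi]
  simp_rw [charFun_stdComplexGaussian]
  rw [← Complex.exp_sum, ← Complex.ofReal_pow, EuclideanSpace.norm_sq_eq]
  congr 1
  push_cast
  rw [← Finset.sum_div, Finset.sum_neg_distrib]

lemma finrank_real_euclideanSpace (n : ℕ) :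
    Module.finrank ℝ (EuclideanSpace ℂ (Fin n)) = 2 * n := by
  rw [← Module.finrank_mul_finrank ℝ ℂ, Complex.finrank_real_complex, finrank_euclideanSpace,
    Fintype.card_fin]

lemma complexGaussian_absolutelyContinuous (n : ℕ) : complexGaussian n ≪ volume := by
  rw [eq_withDensity_of_charFun (charFun_complexGaussian (n := n))]
  exact withDensity_absolutelyContinuous _ _

lemma complexGaussian_submodule {n : ℕ} (S : Submodule ℂ (EuclideanSpace ℂ (Fin n)))
    (hS : S ≠ ⊤) : complexGaussian n S = 0 := by
  refine complexGaussian_absolutelyContinuous n ?_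
  exact Measure.addHaar_submodule volume (S.restrictScalars ℝ)
    (by rwa [Ne, Submodule.restrictScalars_eq_top_iff])

/-- At most `N` independent Gaussian vectors of `ℂᴺ` are almost surely linearly independent: each
one avoids the proper subspace spanned by the others. -/
lemma ae_linearIndependent {N : ℕ} (n : ℕ) (hn : n ≤ N) :
    ∀ᵐ B ∂(Measure.pi fun _ : Fin n => complexGaussian N), LinearIndependent ℂ B := by
  induction n with
  | zero => exact Eventually.of_forall fun B => linearIndependent_empty_type
  | succ n ih =>
    have hmp := measurePreserving_piFinSuccAbove (fun _ : Fin (n + 1) => complexGaussian N) 0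
    have hset : MeasurableSet {p : EuclideanSpace ℂ (Fin N) × (Fin n → EuclideanSpace ℂ (Fin N)) |
        ¬ LinearIndependent ℂ (Fin.cons p.1 p.2 : Fin (n + 1) → EuclideanSpace ℂ (Fin N))} := by
      have hc : Continuous fun p : EuclideanSpace ℂ (Fin N) × (Fin n → EuclideanSpace ℂ (Fin N)) =>
          (Fin.cons p.1 p.2 : Fin (n + 1) → EuclideanSpace ℂ (Fin N)) := by
        refine continuous_pi fun j => ?_
        refine Fin.cases ?_ (fun j => ?_) j
        · simpa using continuous_fst
        · simp only [Fin.cons_succ]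
          fun_prop
      exact (isOpen_setOfPred_linearIndependent.preimage hc).measurableSet.compl
    have hprod : ∀ᵐ p ∂((complexGaussian N).prod (Measure.pi fun _ : Fin n => complexGaussian N)),
        LinearIndependent ℂ (Fin.cons p.1 p.2 : Fin (n + 1) → EuclideanSpace ℂ (Fin N)) := by
      rw [ae_iff, Measure.prod_apply_symm hset, lintegral_eq_zero_iff
        (measurable_measure_prodMk_right hset)]
      filter_upwards [ih (by omega)] with B hB
      have hspan : Submodule.span ℂ (Set.range B) ≠ ⊤ := by
        intro h
        have := finrank_span_eq_card hB
        rw [h, finrank_top, finrank_euclideanSpace, Fintype.card_fin, Fintype.card_fin] at this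
        omega
      refine (measure_mono_null ?_ (complexGaussian_submodule _ hspan) :)
      intro x hx
      by_contra hx'
      exact hx (linearIndependent_finCons.2 ⟨hB, hx'⟩)
    filter_upwards [hmp.quasiMeasurePreserving.ae hprod] with B hB
    convert hB using 1
    ext1 j
    refine Fin.cases ?_ (fun j => ?_) j <;> simp [MeasurableEquiv.piFinSuccAbove,
      Fin.insertNthEquiv, Fin.tail]

/-! ### Distance from the span of the interfering columns -/

/-- The distance from `h` to the span of the vectors `B j`. Written as an infimum over the
coefficients, it is visibly upper semicontinuous in `(h, B)`. -/
noncomputable def residual {N n : ℕ}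
    (p : EuclideanSpace ℂ (Fin N) × (Fin n → EuclideanSpace ℂ (Fin N))) : ℝ :=
  ⨅ c : Fin n → ℂ, ‖p.1 - ∑ j, c j • p.2 j‖

lemma measurable_residual {N n : ℕ} : Measurable (residual (N := N) (n := n)) := by
  refine (upperSemicontinuous_ciInf (fun p => ⟨0, ?_⟩) fun c => ?_).measurable
  · rintro _ ⟨c, rfl⟩
    exact norm_nonneg _
  · exact Continuous.upperSemicontinuous (by fun_prop)

section Frame

variable {N n r : ℕ} {L : EuclideanSpace ℂ (Fin r) →ₗ[ℂ] EuclideanSpace ℂ (Fin N)}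

-- `L.adjoint ∘ₗ L = id` is the coordinate-free form of `Uᴴ * U = 1`.

lemma norm_apply_of_adjoint_comp_self (hL : L.adjoint ∘ₗ L = LinearMap.id)
    (y : EuclideanSpace ℂ (Fin r)) : ‖L y‖ = ‖y‖ := by
  have h : inner ℂ (L y) (L y) = inner ℂ y y := by
    rw [← LinearMap.adjoint_inner_right, ← LinearMap.comp_apply, hL, LinearMap.id_apply]
  rw [inner_self_eq_norm_sq_to_K, inner_self_eq_norm_sq_to_K] at h
  have h' : ‖L y‖ ^ 2 = ‖y‖ ^ 2 := by exact_mod_cast h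
  exact (pow_left_inj₀ (norm_nonneg _) (norm_nonneg _) two_ne_zero).1 h'

lemma norm_adjoint_apply_le (hL : L.adjoint ∘ₗ L = LinearMap.id)
    (x : EuclideanSpace ℂ (Fin N)) : ‖L.adjoint x‖ ≤ ‖x‖ := by
  by_cases h0 : ‖L.adjoint x‖ = 0
  · rw [h0]; exact norm_nonneg _
  have h1 : ‖inner ℂ (L.adjoint x) (L.adjoint x)‖ ≤ ‖L.adjoint x‖ * ‖x‖ := by
    rw [LinearMap.adjoint_inner_right]
    exact (norm_inner_le_norm _ _).trans_eq (by rw [norm_apply_of_adjoint_comp_self hL])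
  rw [inner_self_eq_norm_sq_to_K] at h1
  have h2 : ‖L.adjoint x‖ * ‖L.adjoint x‖ ≤ ‖L.adjoint x‖ * ‖x‖ := by
    simpa [sq] using h1
  exact le_of_mul_le_mul_left h2 (lt_of_le_of_ne (norm_nonneg _) (Ne.symm h0))

/-- If the columns of a frame are `r` orthonormal vectors orthogonal to `n` linearly independent
vectors of a space of dimension `n + r`, they span the orthogonal complement of these vectors, so
that the component of `h` along the frame has length equal to the distance of `h` from the span of
the vectors, whichever frame is chosen. -/
lemma residual_eq_norm_adjoint (hL : L.adjoint ∘ₗ L = LinearMap.id) (hN : N = n + r)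
    {B : Fin n → EuclideanSpace ℂ (Fin N)} (hB : LinearIndependent ℂ B)
    (hLB : ∀ j, L.adjoint (B j) = 0) (h : EuclideanSpace ℂ (Fin N)) :
    residual (h, B) = ‖L.adjoint h‖ := by
  have hker : Submodule.span ℂ (Set.range B) = LinearMap.ker L.adjoint := by
    refine Submodule.eq_of_le_of_finrank_eq ?_ ?_
    · rw [Submodule.span_le]
      rintro _ ⟨j, rfl⟩
      exact hLB j
    · have hsurj : LinearMap.range L.adjoint = ⊤ :=
        LinearMap.range_eq_top.2 fun y => ⟨L y, LinearMap.congr_fun hL y⟩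
      have := LinearMap.finrank_range_add_finrank_ker L.adjoint
      rw [hsurj, finrank_top, finrank_euclideanSpace, finrank_euclideanSpace, Fintype.card_fin,
        Fintype.card_fin] at this
      rw [finrank_span_eq_card hB, Fintype.card_fin]
      omega
  have hmem : h - L (L.adjoint h) ∈ Submodule.span ℂ (Set.range B) := by
    have := LinearMap.congr_fun hL (L.adjoint h)
    simp only [LinearMap.comp_apply, LinearMap.id_apply] at this
    rw [hker, LinearMap.mem_ker, map_sub, this, sub_self]
  obtain ⟨c, hc⟩ := (Submodule.mem_span_range_iff_exists_fun ℂ).1 hmem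
  refine le_antisymm ?_ ?_
  · refine (ciInf_le ⟨0, ?_⟩ c).trans_eq ?_
    · rintro _ ⟨c, rfl⟩
      exact norm_nonneg _
    · simp only [hc, sub_sub_cancel]
      exact norm_apply_of_adjoint_comp_self hL _
  · refine le_ciInf fun c => ?_
    have : L.adjoint h = L.adjoint (h - ∑ j, c j • B j) := by
      simp [map_sub, map_sum, hLB]
    rw [this]
    exact norm_adjoint_apply_le hL _

lemma real_inner_eq_re_inner (x y : EuclideanSpace ℂ (Fin n)) :
    (inner ℝ x y : ℝ) = (inner ℂ x y : ℂ).re := by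
  simp only [PiLp.inner_apply, Complex.re_sum]
  rfl

/-- The coordinates of a Gaussian vector along an orthonormal frame are again Gaussian. -/
lemma charFun_map_adjoint (hL : L.adjoint ∘ₗ L = LinearMap.id) (t : EuclideanSpace ℂ (Fin r)) :
    charFun ((complexGaussian N).map L.adjoint) t = Complex.exp (-(‖t‖ : ℂ) ^ 2 / 4) := by
  have hcont : Continuous L.adjoint := LinearMap.continuous_of_finiteDimensional _
  rw [charFun_apply, integral_map hcont.aemeasurable (by fun_prop)]
  have : ∀ x, (inner ℝ (L.adjoint x) t : ℝ) = inner ℝ x (L t) := fun x => by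
    rw [real_inner_eq_re_inner, real_inner_eq_re_inner, LinearMap.adjoint_inner_left]
  simp_rw [this]
  rw [← charFun_apply, charFun_complexGaussian, norm_apply_of_adjoint_comp_self hL]

end Frame

/-- A frame determined by the interfering columns alone; it is therefore independent of the desired
column. -/
lemma exists_frame {N n r : ℕ} (hN : N = n + r) {B : Fin n → EuclideanSpace ℂ (Fin N)}
    (hB : LinearIndependent ℂ B) :
    ∃ L : EuclideanSpace ℂ (Fin r) →ₗ[ℂ] EuclideanSpace ℂ (Fin N),
      L.adjoint ∘ₗ L = LinearMap.id ∧ ∀ j, L.adjoint (B j) = 0 := by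
  set S := Submodule.span ℂ (Set.range B) with hS
  have hr : Module.finrank ℂ Sᗮ = r := by
    have := S.finrank_add_finrank_orthogonal
    rw [show Module.finrank ℂ S = n by rw [hS, finrank_span_eq_card hB, Fintype.card_fin],
      finrank_euclideanSpace, Fintype.card_fin] at this
    omega
  let b := (stdOrthonormalBasis ℂ Sᗮ).reindex (finCongr hr)
  let f : EuclideanSpace ℂ (Fin r) →ₗᵢ[ℂ] EuclideanSpace ℂ (Fin N) :=
    Sᗮ.subtypeₗᵢ.comp b.repr.symm.toLinearIsometry
  refine ⟨f.toLinearMap, ?_, fun j => ?_⟩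
  · ext1 y
    refine ext_inner_right ℂ fun z => ?_
    rw [LinearMap.comp_apply, LinearMap.adjoint_inner_left]
    exact f.inner_map_map y z
  · refine ext_inner_right ℂ fun z => ?_
    rw [LinearMap.adjoint_inner_left, inner_zero_left]
    exact (b.repr.symm z).2 _ (Submodule.subset_span ⟨j, rfl⟩)

/-- Given the `n` interfering columns, the squared distance of a Gaussian vector from their span
follows the Gamma law of shape `N - n`. The law does not depend on the columns, so it is also the
unconditional law. -/
lemma measureReal_sq_residual_le {N n d : ℕ} (hN : N = n + (d + 1)) {e : ℝ} (he : 0 ≤ e) :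
    ((complexGaussian N).prod (Measure.pi fun _ : Fin n => complexGaussian N)).real
      {p | residual p ^ 2 ≤ e} = lowerGamma ((d : ℝ) + 1) e / (d ! : ℝ) := by
  have hmeas : MeasurableSet {p : EuclideanSpace ℂ (Fin N) × (Fin n → EuclideanSpace ℂ (Fin N)) |
      residual p ^ 2 ≤ e} :=
    measurableSet_le (measurable_residual.pow_const 2) measurable_const
  have hcond : ∀ᵐ B ∂(Measure.pi fun _ : Fin n => complexGaussian N),
      complexGaussian N {h | residual (h, B) ^ 2 ≤ e} =
        ENNReal.ofReal (lowerGamma ((d : ℝ) + 1) e / (d ! : ℝ)) := by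
    filter_upwards [ae_linearIndependent (N := N) n (by omega)] with B hB
    obtain ⟨L, hL, hLB⟩ := exists_frame hN hB
    have hcont : Continuous L.adjoint := LinearMap.continuous_of_finiteDimensional _
    have : IsProbabilityMeasure ((complexGaussian N).map L.adjoint) :=
      Measure.isProbabilityMeasure_map hcont.aemeasurable
    have hlaw := measureReal_sq_norm_le (charFun_map_adjoint hL) d
      (finrank_real_euclideanSpace (d + 1)) he
    rw [← hlaw, ofReal_measureReal, Measure.map_apply hcont.measurable
      (measurableSet_le (by fun_prop) measurable_const)]
    simp_rw [residual_eq_norm_adjoint hL hN hB hLB]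
    rfl
  have hnn : 0 ≤ lowerGamma ((d : ℝ) + 1) e / (d ! : ℝ) :=
    div_nonneg (le_trans (by positivity) (le_lowerGamma d he)) (by positivity)
  rw [measureReal_def, Measure.prod_apply_symm hmeas]
  have : ∀ᵐ B ∂(Measure.pi fun _ : Fin n => complexGaussian N),
      complexGaussian N ((fun h => (h, B)) ⁻¹' {p | residual p ^ 2 ≤ e}) =
        ENNReal.ofReal (lowerGamma ((d : ℝ) + 1) e / (d ! : ℝ)) := hcond
  rw [lintegral_congr_ae this, lintegral_const, measure_univ, mul_one, ENNReal.toReal_ofReal hnn]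

/-! ### Gain and SINR for a given channel -/

section Deterministic

variable {N M K r : ℕ} {i : Fin M} {H : Matrix (Fin N) (Fin M) ℂ} {U : Matrix (Fin N) (Fin r) ℂ}

lemma toEuclideanLin_adjoint_comp_self (hU : Uᴴ * U = 1) :
    (Matrix.toEuclideanLin U).adjoint ∘ₗ Matrix.toEuclideanLin U = LinearMap.id := by
  rw [← Matrix.toEuclideanLin_conjTranspose_eq_adjoint]
  ext1 y
  simp [Matrix.toLpLin_apply, Matrix.mulVec_mulVec, hU]

lemma IsLeftNullFrame.conjTranspose_mulVec_eq_zero (hU : IsLeftNullFrame (interference i H) U)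
    {m : Fin M} (hm : m ≠ i) : Uᴴ *ᵥ (fun n => H n m) = 0 := by
  ext a
  have := congr_fun (congr_fun hU.2 a) ⟨m, hm⟩
  simpa [Matrix.mul_apply, Matrix.mulVec, dotProduct, interference] using this

lemma star_detection_dotProduct (x : Fin N → ℂ) :
    star (detection i H U) ⬝ᵥ x =
      (vecNorm (Uᴴ *ᵥ fun n => H n i) : ℂ)⁻¹ *
        (star (Uᴴ *ᵥ fun n => H n i) ⬝ᵥ (Uᴴ *ᵥ x)) := by
  rw [detection, Matrix.star_mulVec, ← Matrix.dotProduct_mulVec, mrc, star_smul, smul_dotProduct]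
  simp

lemma gain_one_col (v : Fin N → ℂ) (m : Fin M) :
    gain v H (fun a => (1 : Matrix (Fin M) (Fin M) ℂ) a m) = ‖star v ⬝ᵥ fun n => H n m‖ ^ 2 := by
  have : H *ᵥ (fun a => (1 : Matrix (Fin M) (Fin M) ℂ) a m) = fun n => H n m := by
    ext n
    simp [Matrix.mulVec, dotProduct, Matrix.one_apply]
  rw [gain, this]

lemma vecNorm_nonneg {n : ℕ} (v : Fin n → ℂ) : 0 ≤ vecNorm v := norm_nonneg _

lemma star_dotProduct_self_eq {n : ℕ} (y : Fin n → ℂ) :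
    star y ⬝ᵥ y = (vecNorm y : ℂ) ^ 2 := by
  have h := inner_self_eq_norm_sq_to_K (𝕜 := ℂ) (WithLp.toLp 2 y : EuclideanSpace ℂ (Fin n))
  rw [EuclideanSpace.inner_eq_star_dotProduct, dotProduct_comm] at h
  exact h

/-- With maximal ratio combining the effective gain is the squared length of the projected
channel. -/
lemma gain_detection_self : gain (detection i H U) H
    (fun a => (1 : Matrix (Fin M) (Fin M) ℂ) a i) = vecNorm (Uᴴ *ᵥ fun n => H n i) ^ 2 := by
  rw [gain_one_col, star_detection_dotProduct, star_dotProduct_self_eq]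
  by_cases h : vecNorm (Uᴴ *ᵥ fun n => H n i) = 0
  · simp [h]
  · have : ((vecNorm (Uᴴ *ᵥ fun n => H n i) : ℂ))⁻¹ * (vecNorm (Uᴴ *ᵥ fun n => H n i) : ℂ) ^ 2 =
        (vecNorm (Uᴴ *ᵥ fun n => H n i) : ℂ) := by
      have : (vecNorm (Uᴴ *ᵥ fun n => H n i) : ℂ) ≠ 0 := by exact_mod_cast h
      field_simp
    rw [this, Complex.norm_real, Real.norm_of_nonneg (vecNorm_nonneg _)]

lemma gain_detection_of_ne (hU : IsLeftNullFrame (interference i H) U) {m : Fin M} (hm : m ≠ i) :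
    gain (detection i H U) H (fun a => (1 : Matrix (Fin M) (Fin M) ℂ) a m) = 0 := by
  rw [gain_one_col, star_detection_dotProduct, hU.conjTranspose_mulVec_eq_zero hm]
  simp

lemma vecNorm_detection (hU : IsLeftNullFrame (interference i H) U)
    (h : vecNorm (Uᴴ *ᵥ fun n => H n i) ≠ 0) : vecNorm (detection i H U) = 1 := by
  have h1 : vecNorm (detection i H U) = vecNorm (mrc U fun n => H n i) :=
    norm_apply_of_adjoint_comp_self (toEuclideanLin_adjoint_comp_self hU.1)
      (WithLp.toLp 2 (mrc U fun n => H n i))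
  have h2 : vecNorm (mrc U fun n => H n i) =
      ‖((vecNorm (Uᴴ *ᵥ fun n => H n i) : ℂ))⁻¹‖ * vecNorm (Uᴴ *ᵥ fun n => H n i) := by
    rw [mrc, vecNorm, WithLp.toLp_smul, norm_smul]
    rfl
  rw [h1, h2, norm_inv, Complex.norm_real, Real.norm_of_nonneg (vecNorm_nonneg _),
    inv_mul_cancel₀ h]

lemma eps_pos {R : Fin K → ℝ} {j : Fin K} (hR : 0 < R j) : 0 < eps R j :=
  sub_pos.2 (Real.one_lt_rpow one_lt_two hR)

/-- Message `j` is decodable exactly when the effective gain exceeds the threshold that `ε j`,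
`α j ^ 2 - β j` and the SNR determine. When the gain vanishes, so does the detection vector, and
both sides fail. -/
lemma lt_logb_sinr_iff (hU : IsLeftNullFrame (interference i H) U) {α R : Fin K → ℝ} {ρ : ℝ}
    (hρ : 0 < ρ) {j : Fin K} (hR : 0 < R j) :
    R j < Real.logb 2 (1 + sinr 1 i H (detection i H U) α ρ j) ↔
      eps R j / ρ < vecNorm (Uᴴ *ᵥ fun n => H n i) ^ 2 * (α j ^ 2 - beta α R j) := by
  set s := vecNorm (Uᴴ *ᵥ fun n => H n i) with hs
  have hint : ∑ m ∈ Finset.univ.erase i, gain (detection i H U) H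
      (fun a => (1 : Matrix (Fin M) (Fin M) ℂ) a m) = 0 :=
    Finset.sum_eq_zero fun m hm => gain_detection_of_ne hU (Finset.ne_of_mem_erase hm)
  have hsinr : sinr 1 i H (detection i H U) α ρ j = s ^ 2 * α j ^ 2 /
      (s ^ 2 * ∑ l ∈ Finset.Iio j, α l ^ 2 + vecNorm (detection i H U) ^ 2 * (1 / ρ)) := by
    rw [sinr, hint, gain_detection_self, add_zero, Finset.mul_sum]
  have hsum : 0 ≤ ∑ l ∈ Finset.Iio j, α l ^ 2 := Finset.sum_nonneg fun l _ => sq_nonneg _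
  have h0 : 0 ≤ sinr 1 i H (detection i H U) α ρ j := by
    rw [hsinr]; positivity
  have heps := eps_pos hR
  rw [Real.lt_logb_iff_rpow_lt one_lt_two (by linarith), ← sub_lt_iff_lt_add', hsinr]
  change eps R j < _ ↔ _
  by_cases h : s = 0
  · have : 0 < eps R j / ρ := by positivity
    simp [h, heps.not_gt, this.not_gt]
  · rw [vecNorm_detection hU h, one_pow, one_mul, lt_div_iff₀ (by positivity), beta]
    have : eps R j * (s ^ 2 * ∑ l ∈ Finset.Iio j, α l ^ 2 + 1 / ρ) =
      eps R j / ρ + s ^ 2 * (eps R j * ∑ l ∈ Finset.Iio j, α l ^ 2) := by ring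
    rw [this, mul_sub, lt_sub_iff_add_lt]

lemma epsStar_lt_iff {α R : Fin K → ℝ} {k : Fin K} {ρ : ℝ}
    (hα : ∀ j, k ≤ j → beta α R j < α j ^ 2) (g : ℝ) :
    epsStar α R k ρ < g ↔ ∀ j, k ≤ j → eps R j / ρ < g * (α j ^ 2 - beta α R j) := by
  refine (Finset.sup'_lt_iff _).trans ?_
  refine forall_congr' fun j => ?_
  rw [Finset.mem_Ici]
  refine imp_congr_right fun hj => ?_
  rw [← div_div, div_lt_iff₀ (sub_pos.2 (hα j hj))]

lemma epsStar_eq_div (α R : Fin K → ℝ) (k : Fin K) {ρ : ℝ} (hρ : 0 < ρ) :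
    epsStar α R k ρ = epsStar α R k 1 / ρ := by
  have hne : (Finset.Ici k).Nonempty := ⟨k, Finset.mem_Ici.2 le_rfl⟩
  have hsup : ∀ x y : ℝ, (x ⊔ y) / ρ = x / ρ ⊔ y / ρ := fun x y =>
    (max_div_div_right hρ.le x y).symm
  refine Eq.trans ?_ (Finset.apply_sup'_eq_sup'_comp hne (fun x : ℝ => x / ρ) hsup).symm
  refine Finset.sup'_congr hne rfl fun j _ => ?_
  simp only [Function.comp_apply, one_mul]
  rw [div_div, mul_comm]

lemma epsStar_pos {α R : Fin K → ℝ} (hR : ∀ j, 0 < R j) {k : Fin K} {ρ : ℝ} (hρ : 0 < ρ)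
    (hα : ∀ j, k ≤ j → beta α R j < α j ^ 2) : 0 < epsStar α R k ρ := by
  refine (Finset.lt_sup'_iff _).2 ⟨k, Finset.mem_Ici.2 le_rfl, ?_⟩
  exact div_pos (eps_pos (hR k)) (mul_pos hρ (sub_pos.2 (hα k le_rfl)))

end Deterministic

/-- The channel matrix as the pair of its `i`-th column and the family of its other columns. -/
def splitColumns {N n : ℕ} (i : Fin (n + 1)) (H : Matrix (Fin N) (Fin (n + 1)) ℂ) :
    EuclideanSpace ℂ (Fin N) × (Fin n → EuclideanSpace ℂ (Fin N)) :=
  (WithLp.toLp 2 fun a => H a i, fun j => WithLp.toLp 2 fun a => H a (i.succAbove j))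

lemma vecNorm_conjTranspose_mulVec_eq_residual {N n r : ℕ} (hN : N = n + r) {i : Fin (n + 1)}
    {H : Matrix (Fin N) (Fin (n + 1)) ℂ} {U : Matrix (Fin N) (Fin r) ℂ}
    (hU : IsLeftNullFrame (interference i H) U)
    (hB : LinearIndependent ℂ (splitColumns i H).2) :
    vecNorm (Uᴴ *ᵥ fun a => H a i) = residual (splitColumns i H) := by
  have h := residual_eq_norm_adjoint (toEuclideanLin_adjoint_comp_self hU.1) hN hB (fun j => ?_)
    (splitColumns i H).1
  · rw [h, ← Matrix.toEuclideanLin_conjTranspose_eq_adjoint]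
    rfl
  · rw [← Matrix.toEuclideanLin_conjTranspose_eq_adjoint]
    exact congr_arg (WithLp.toLp 2)
      (hU.conjTranspose_mulVec_eq_zero (i.succAbove_ne j))

/-! ### Rayleigh fading -/

section Probability

variable {Ω : Type*} [MeasurableSpace Ω] {μ : Measure Ω} [IsProbabilityMeasure μ]

/-- Grouping i.i.d. variables indexed by a product into blocks indexed by the first factor. -/
lemma iIndepFun_hasLaw_block {ι κ 𝓧 : Type*} [Fintype ι] [Fintype κ] [MeasurableSpace 𝓧]
    {ν : Measure 𝓧} [IsProbabilityMeasure ν] {Z : ι × κ → Ω → 𝓧} (hlaw : ∀ p, HasLaw (Z p) ν μ)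
    (hind : iIndepFun Z μ) :
    iIndepFun (fun (i : ι) ω (j : κ) => Z (i, j) ω) μ ∧
      ∀ i, HasLaw (fun ω (j : κ) => Z (i, j) ω) (Measure.pi fun _ => ν) μ := by
  have hpi : HasLaw (fun ω p => Z p ω) (Measure.pi fun _ : ι × κ => ν) μ := hind.hasLaw_pi hlaw
  have hcurry : HasLaw (MeasurableEquiv.curry ι κ 𝓧)
      (Measure.pi fun _ : ι => Measure.pi fun _ : κ => ν) (Measure.pi fun _ : ι × κ => ν) := by
    refine ⟨(MeasurableEquiv.curry ι κ 𝓧).measurable.aemeasurable, ?_⟩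
    simp_rw [← Measure.infinitePi_eq_pi]
    exact Measure.infinitePi_map_curry (fun _ _ => ν)
  have hblock : HasLaw (fun ω (i : ι) (j : κ) => Z (i, j) ω)
      (Measure.pi fun _ : ι => Measure.pi fun _ : κ => ν) μ := hcurry.comp hpi
  have hmarg : ∀ i, HasLaw (fun ω (j : κ) => Z (i, j) ω) (Measure.pi fun _ => ν) μ := fun i =>
    (measurePreserving_eval (fun _ : ι => Measure.pi fun _ : κ => ν) i).hasLaw.comp hblock
  exact ⟨(iIndepFun_iff_hasLaw_pi_pi hmarg).2 hblock, hmarg⟩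

variable {N n K : ℕ} {H : Fin K → Ω → Matrix (Fin N) (Fin (n + 1)) ℂ}

/-- Entries are grouped into columns, and columns into channel matrices. -/
lemma IsRayleighFading.iIndepFun_hasLaw_splitColumns (hH : IsRayleighFading H μ)
    (i : Fin (n + 1)) :
    iIndepFun (fun u ω => splitColumns i (H u ω)) μ ∧
      ∀ u, HasLaw (fun ω => splitColumns i (H u ω))
        ((complexGaussian N).prod (Measure.pi fun _ => complexGaussian N)) μ := by
  have hinj : Function.Injective
      (fun p : (Fin K × Fin (n + 1)) × Fin N => (p.1.1, p.2, p.1.2)) := by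
    rintro ⟨⟨a, b⟩, c⟩ ⟨⟨a', b'⟩, c'⟩ h
    simp only [Prod.mk.injEq] at h
    simp [h]
  have hcol := iIndepFun_hasLaw_block
    (Z := fun (p : (Fin K × Fin (n + 1)) × Fin N) ω => H p.1.1 ω p.2 p.1.2)
    (fun p => hH.law _ _ _) (hH.indep.precomp hinj)
  have htoLp : HasLaw (WithLp.toLp 2) (complexGaussian N)
      (Measure.pi fun _ : Fin N => stdComplexGaussian) := ⟨by fun_prop, rfl⟩
  have hmat := iIndepFun_hasLaw_block
    (Z := fun (p : Fin K × Fin (n + 1)) ω =>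
      (WithLp.toLp 2 fun a => H p.1 ω a p.2 : EuclideanSpace ℂ (Fin N)))
    (fun p => htoLp.comp (hcol.2 p)) (hcol.1.comp (fun _ => WithLp.toLp 2) fun _ => by fun_prop)
  have hsplit := measurePreserving_piFinSuccAbove (fun _ : Fin (n + 1) => complexGaussian N) i
  exact ⟨hmat.1.comp (fun _ => MeasurableEquiv.piFinSuccAbove
    (fun _ : Fin (n + 1) => EuclideanSpace ℂ (Fin N)) i) fun _ => hsplit.measurable,
    fun u => hsplit.hasLaw.comp (hmat.2 u)⟩

lemma ae_vecNorm_eq_residual {r : ℕ} (hN : N = n + r) (i : Fin (n + 1))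
    (hH : IsRayleighFading H μ) {U : Fin K → Ω → Matrix (Fin N) (Fin r) ℂ}
    (hU : ∀ u, ∀ᵐ ω ∂μ, IsLeftNullFrame (interference i (H u ω)) (U u ω)) :
    ∀ᵐ ω ∂μ, ∀ u,
      vecNorm ((U u ω)ᴴ *ᵥ fun a => H u ω a i) = residual (splitColumns i (H u ω)) := by
  refine ae_all_iff.2 fun u => ?_
  have hlaw := (hH.iIndepFun_hasLaw_splitColumns i).2 u
  have hlin : ∀ᵐ ω ∂μ, LinearIndependent ℂ (splitColumns i (H u ω)).2 := by
    refine ae_of_ae_map (p := fun p => LinearIndependent ℂ p.2) hlaw.aemeasurable ?_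
    rw [hlaw.map_eq]
    exact Measure.quasiMeasurePreserving_snd.ae (ae_linearIndependent n (by omega))
  filter_upwards [hU u, hlin] with ω hUω hlinω
  exact vecNorm_conjTranspose_mulVec_eq_residual hN hUω hlinω

lemma ae_antitone_residual {r : ℕ} (hN : N = n + r) (i : Fin (n + 1))
    (hH : IsRayleighFading H μ) {U : Fin K → Ω → Matrix (Fin N) (Fin r) ℂ}
    (hU : ∀ u, ∀ᵐ ω ∂μ, IsLeftNullFrame (interference i (H u ω)) (U u ω))
    {σ : Ω → Equiv.Perm (Fin K)}
    (hσ : ∀ᵐ ω ∂μ, IsGainOrdering i (fun u => H u ω) (fun u => U u ω) (σ ω)) :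
    ∀ᵐ ω ∂μ, Antitone fun l => residual (splitColumns i (H (σ ω l) ω)) ^ 2 := by
  filter_upwards [ae_vecNorm_eq_residual hN i hH hU, hσ] with ω hres hσω
  simpa only [IsGainOrdering, gain_detection_self, hres] using hσω

/-- The outage probability in terms of the distances between the desired channel columns and the
spans of the interfering ones, which no longer involves the frames `U`. -/
lemma outageProb_eq {r : ℕ} (hN : N = n + r) (i : Fin (n + 1)) (hH : IsRayleighFading H μ)
    {U : Fin K → Ω → Matrix (Fin N) (Fin r) ℂ}
    (hU : ∀ u, ∀ᵐ ω ∂μ, IsLeftNullFrame (interference i (H u ω)) (U u ω))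
    (σ : Ω → Equiv.Perm (Fin K)) {α R : Fin K → ℝ} (hR : ∀ j, 0 < R j) (k : Fin K) {ρ : ℝ}
    (hρ : 0 < ρ) :
    outageProb μ i H U σ α R k ρ = μ.real {ω | ¬ ∀ j, k ≤ j → eps R j / ρ <
        residual (splitColumns i (H (σ ω k) ω)) ^ 2 * (α j ^ 2 - beta α R j)} := by
  refine measureReal_congr ?_
  filter_upwards [ae_all_iff.2 hU, ae_vecNorm_eq_residual hN i hH hU] with ω hUω hres
  refine propext ?_
  change (¬ ∀ j : Fin K, k ≤ j → _) ↔ (¬ ∀ j, k ≤ j → _)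
  simp only [lt_logb_sinr_iff (hUω _) hρ (hR _), hres]

end Probability

end MimoNoma

open MimoNoma in
theorem theorem1 {Ω : Type*} [MeasurableSpace Ω] (μ : Measure Ω) [IsProbabilityMeasure μ]
    {N M K : ℕ} (hMN : M ≤ N) (i : Fin M)
    (H : Fin K → Ω → Matrix (Fin N) (Fin M) ℂ) (hH : MimoNoma.IsRayleighFading H μ)
    (U : Fin K → Ω → Matrix (Fin N) (Fin (N - M + 1)) ℂ)
    (hU : ∀ u, ∀ᵐ ω ∂μ, MimoNoma.IsLeftNullFrame (MimoNoma.interference i (H u ω)) (U u ω))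
    (σ : Ω → Equiv.Perm (Fin K))
    (hσ : ∀ᵐ ω ∂μ, MimoNoma.IsGainOrdering i (fun u => H u ω) (fun u => U u ω) (σ ω))
    (α R : Fin K → ℝ) (hR : ∀ j, 0 < R j) (k : Fin K) :
    ((∀ j, k ≤ j → MimoNoma.beta α R j < α j ^ 2) →
      (∀ ρ : ℝ, 0 < ρ →
        MimoNoma.outageProb μ i H U σ α R k ρ =
          MimoNoma.outageClosedForm N M K (k + 1) (MimoNoma.epsStar α R k ρ)) ∧
      (fun ρ : ℝ => MimoNoma.outageProb μ i H U σ α R k ρ) ~[atTop]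
        (fun ρ : ℝ => MimoNoma.outageHighSNR N M K (k + 1) (MimoNoma.epsStar α R k ρ)) ∧
      Tendsto (fun ρ : ℝ => -Real.log (MimoNoma.outageProb μ i H U σ α R k ρ) / Real.log ρ)
        atTop (𝓝 ((((N - M + 1) * (K - (k + 1) + 1) : ℕ)) : ℝ))) ∧
    ((¬ ∀ j, k ≤ j → MimoNoma.beta α R j < α j ^ 2) →
      ∀ ρ : ℝ, 0 < ρ → MimoNoma.outageProb μ i H U σ α R k ρ = 1) := by
  obtain ⟨n, rfl⟩ : ∃ n, M = n + 1 := ⟨M - 1, by have := i.2; omega⟩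
  have hN : N = n + (N - (n + 1) + 1) := by omega
  have hanti : ∀ᵐ ω ∂μ, Antitone fun l => residual (splitColumns i (H (σ ω l) ω)) ^ 2 :=
    ae_antitone_residual hN i hH hU hσ
  refine ⟨fun hα => ?_, fun hα ρ hρ => ?_⟩
  · have hclosed : ∀ ρ : ℝ, 0 < ρ → outageProb μ i H U σ α R k ρ =
        outageClosedForm N (n + 1) K (k + 1) (epsStar α R k ρ) := by
      intro ρ hρ
      have hsplit := hH.iIndepFun_hasLaw_splitColumns i
      have hmeas : Measurable fun p :
          EuclideanSpace ℂ (Fin N) × (Fin n → EuclideanSpace ℂ (Fin N)) => residual p ^ 2 := measurable_residual.pow_const 2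
      have hcdf : ∀ u, μ.real {ω | residual (splitColumns i (H u ω)) ^ 2 ≤ epsStar α R k ρ} =
          lowerGamma (((N - (n + 1) : ℕ) : ℝ) + 1) (epsStar α R k ρ) / ((N - (n + 1))! : ℝ) := by
        intro u
        rw [← measureReal_sq_residual_le hN (epsStar_pos hR hρ hα).le]
        exact (hsplit.2 u).measureReal_eq (measurableSet_le hmeas measurable_const)
      have hcount := measureReal_card_lt_le
        (g := fun u ω => residual (splitColumns i (H u ω)) ^ 2)
        (fun u => hmeas.comp_aemeasurable (hsplit.2 u).aemeasurable)
        (hsplit.1.comp (fun _ p => residual p ^ 2) fun _ => hmeas) hcdf k.2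
      rw [outageProb_eq hN i hH hU σ hR k hρ, outageClosedForm, ← Nat.cast_sub hMN]
      simp only [Nat.add_sub_cancel]
      rw [← binomialTail_eq K k k.2, ← hcount]
      refine measureReal_congr ?_
      filter_upwards [hanti] with ω hω
      refine propext ?_
      change (¬ ∀ j, k ≤ j → _) ↔ _ ≤ (k : ℕ)
      rw [← epsStar_lt_iff hα, not_lt]
      exact le_iff_card_lt_le (fun u => residual (splitColumns i (H u ω)) ^ 2) (σ ω) hω k _
    have hequiv : (fun ρ : ℝ => outageProb μ i H U σ α R k ρ) ~[atTop]
        (fun ρ : ℝ => outageHighSNR N (n + 1) K (k + 1) (epsStar α R k ρ)) := by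
      have hlim : Tendsto (fun ρ => epsStar α R k ρ) atTop (𝓝[>] 0) := by
        refine tendsto_nhdsWithin_iff.2 ⟨?_, ?_⟩
        · refine (tendsto_const_nhds.div_atTop tendsto_id :
            Tendsto (fun ρ : ℝ => epsStar α R k 1 / ρ) atTop (𝓝 0)).congr' ?_
          filter_upwards [eventually_gt_atTop 0] with ρ hρ
          exact (epsStar_eq_div α R k hρ).symm
        · filter_upwards [eventually_gt_atTop 0] with ρ hρ
          exact epsStar_pos hR hρ hα
      refine ((isEquivalent_outageClosedForm hMN k.2).comp_tendsto hlim).congr_left ?_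
      filter_upwards [eventually_gt_atTop 0] with ρ hρ
      exact (hclosed ρ hρ).symm
    refine ⟨hclosed, hequiv, ?_⟩
    refine tendsto_neg_log_div_log k.2 (epsStar_pos hR one_pos hα) (hequiv.congr_right ?_)
    filter_upwards [eventually_gt_atTop 0] with ρ hρ
    rw [epsStar_eq_div α R k hρ]
  · have huniv : {ω | ¬ ∀ j, k ≤ j → eps R j / ρ <
        residual (splitColumns i (H (σ ω k) ω)) ^ 2 * (α j ^ 2 - beta α R j)} = Set.univ := by
      refine Set.eq_univ_of_forall fun ω h => hα fun j hj => ?_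
      have h1 : 0 < residual (splitColumns i (H (σ ω k) ω)) ^ 2 * (α j ^ 2 - beta α R j) :=
        (div_pos (eps_pos (hR j)) hρ).trans (h j hj)
      exact sub_pos.1 (pos_of_mul_pos_right h1 (sq_nonneg _))
    rw [outageProb_eq hN i hH hU σ hR k hρ, huniv, probReal_univ]
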